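/- Let $\underline{C}$ be a (locally small) triangulated category that has all small coproducts. For a class $\mathcal{Q}$ of objects of $\underline C$, write $\mathcal{Q}^\perp=\{N : \underline{C}(M,N)=0 \text{ for all } M\in \mathcal{Q}\}$, and let $[\mathcal{Q}]^{cl}$ be the smallest class of objects that contains $\mathcal{Q}$ and is closed under small coproducts and under extensions (if $A\to B\to D\to A[1]$ is distinguished and $A,D$ are in the class, then so is $B$). Let $P$ be an object of $\underline{C}$ such that $\underline C$ is compactly generated by $P$ (that is, $P$ is compact and $[\{P[i] : i\in\mathbb{Z}\}]^{cl}$ is the class of all objects of $\underline{C}$) and $P$ is connective, i.e. $\underline{C}(P,P[i])=0$ for all $i>0$. Let $R=\mathrm{End}(P)^{op}$, let $R\text{-Mod}$ be the category of left $R$-modules, and let $\mathrm{Proj}\,R\text{-Mod}$ be its full subcategory of projective modules. A weight structure $w$ on $\underline{C}$ is a pair of classes $\underline{C}_{w\le 0},\underline{C}_{w\ge 0}$ closed under direct summands such that $\underline{C}_{w\le 0}\subset \underline{C}_{w\le 0}[1]$, $\underline{C}_{w\ge 0}[1]\subset \underline{C}_{w\ge 0}$, there are no non-zero morphisms from $\underline{C}_{w\le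 0}$ to $\underline{C}_{w\ge 0}[1]$, and each object $M$ lies in a distinguished triangle $L\to M\to N\to L[1]$ with $L\in \underline{C}_{w\le 0}$, $N\in \underline{C}_{w\ge 0}[1]$. Its heart $\underline{Hw}$ is the full subcategory on $\underline{C}_{w=0}=\underline{C}_{w\le 0}\cap\underline{C}_{w\ge 0}$. It is smashing if $\underline{C}_{w\ge 0}$ is closed under small coproducts. For $t$-structures the homological convention is used: $\underline{C}_{t\ge 0}[1]\subset\underline{C}_{t\ge 0}$, there are no non-zero morphisms from $\underline{C}_{t\ge 0}[1]$ to $\underline{C}_{t\le 0}$, and the heart $\underline{Ht}$ is the full subcategory on $\underline{C}_{t\ge 0}\cap \underline{C}_{t\le 0}$. 1. Then $\underline{C}$ is well generated (that is, $\alpha$-well generated for some $\alpha$ that equals $\aleph_0$ or is an infinite successor cardinal: there is a set $\mathcal{P}$ of objects with $[\bigcup_{i\in\mathbb{Z}}\mathcal{P}[i]]^{cl}$ equal to the class of all objects such that $H=\coprod_{X\in\mathcal{P}}\underline{C}(X,-)$ satisfies, for all families, $\varinjlim_{J\subset I,\,|J|<\alpha}H(\coprod_{J}N_i)\cong H(\coprod_I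 N_i)$, and $H(\coprod f_i)$ is surjective whenever all the $H(f_i)$ are). The object $P$ class-generates a smashing weight structure $w$ on $\underline{C}$, i.e. there is a smashing weight structure $w$ with $\underline{C}_{w\ge 0}=[\{P[i] : i\ge 0\}]^{cl}$ and $\underline{C}_{w\le 0}=[\{P[i] : i\le 0\}]^{cl}$. There is an equivalence of categories $\underline{Hw}\cong \mathrm{Proj}\,R\text{-Mod}$, and the elements of $\underline{C}_{w=0}$ are exactly the direct summands of the small coproduct powers $\coprod_I P$. 2. There is a $t$-structure $t$ on $\underline{C}$ that is adjacent to $w$, i.e. $\underline{C}_{t\ge 0}=\underline{C}_{w\ge 0}$, and $\underline{Ht}$ is equivalent to $R\text{-Mod}$. Moreover, $\underline{C}_{t\ge 0}=\underline{C}_{w\ge 0}=\{P[i] : i<0\}^\perp$ and $\underline{C}_{t\le 0}=\{P[i] : i>0\}^\perp$. -/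

import Mathlib

open CategoryTheory Limits Pretriangulated Triangulated Opposite
open scoped Cardinal

universe v u

noncomputable section

namespace WeightT

/-! Throughout, `C : Type u` is a category whose morphism sets lie in `Type v`, and "small" means
indexed by a type in `Type v`. -/

section Coproducts

variable {C : Type u} [Category.{v} C] [HasCoproducts.{v} C]

/-- The diagram of partial coproducts `J ↦ ∐_{i ∈ J} N i`, indexed by the poset of all subsets
`J ⊆ I` of cardinality `< α`. -/
def partialCoproducts (α : Cardinal.{v}) {I : Type v} (N : I → C) :
    {J : Set I // #J < α} ⥤ C where
  obj J := ∐ fun i : J.1 => N i.1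
  map {J J'} h := Sigma.desc fun i : J.1 =>
    Sigma.ι (fun i : J'.1 => N i.1) ⟨i.1, leOfHom h i.2⟩
  map_id J := by ext; simp
  map_comp f g := by ext; simp

/-- The canonical cocone with vertex `∐_{i ∈ I} N i` over the diagram of partial coproducts. -/
def partialCoproductsCocone (α : Cardinal.{v}) {I : Type v} (N : I → C) :
    Cocone (partialCoproducts α N) where
  pt := ∐ N
  ι :=
    { app := fun J => Sigma.desc fun i : J.1 => Sigma.ι N i.1
      naturality := by
        intro J J' h
        dsimp [partialCoproducts]
        ext
        simp }

variable [Preadditive C]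

/-- The functor `H^Q = ∐_{X ∈ Q} C(X, -)` with values in abelian groups, for a small set `Q` of
objects, given as the set of members of a family `p`. -/
def homFunctor {ι : Type v} (p : ι → C) : C ⥤ AddCommGrpCat.{v} :=
  ∐ fun i => preadditiveCoyoneda.obj (op (p i))

/-- The small set of objects `{p i}` is `α`-perfect, where `α` is either `ℵ₀` or an infinite
successor cardinal. -/
structure IsPerfect (α : Cardinal.{v}) {ι : Type v} (p : ι → C) : Prop where
  aleph0_le : ℵ₀ ≤ α
  aleph0_or_succ : α = ℵ₀ ∨ ∃ α' : Cardinal.{v}, α = Order.succ α'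
  /-- `H(∐_I N i)` is the colimit of `H(∐_J N i)`, for `J ⊆ I` of cardinality `< α`. -/
  isColimit {I : Type v} (N : I → C) :
    Nonempty (IsColimit ((homFunctor p).mapCocone (partialCoproductsCocone α N)))
  /-- `H(∐ f i)` is surjective if all the `H(f i)` are. -/
  surjective {I : Type v} {M N : I → C} (f : ∀ i, M i ⟶ N i)
    (hf : ∀ i, Function.Surjective ((homFunctor p).map (f i))) :
    Function.Surjective ((homFunctor p).map (Limits.Sigma.map f))

end Coproducts

variable {C : Type u} [Category.{v} C] [Preadditive C] [HasZeroObject C] [HasShift C ℤ]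
  [∀ n : ℤ, (shiftFunctor C n).Additive] [Pretriangulated C]

/-- `[Q]^cl`: the smallest class of objects that contains `Q`, is closed under small coproducts
and is closed under extensions. -/
inductive extCoprodClosure (Q : ObjectProperty C) : ObjectProperty C
  | of (X : C) (hX : Q X) : extCoprodClosure Q X
  | coproduct {I : Type v} (N : I → C) (c : Cofan N) (hc : IsColimit c)
      (hN : ∀ i, extCoprodClosure Q (N i)) : extCoprodClosure Q c.pt
  | extension (T : Triangle C) (hT : T ∈ distTriang C) (h₁ : extCoprodClosure Q T.obj₁)
      (h₃ : extCoprodClosure Q T.obj₃) : extCoprodClosure Q T.obj₂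

/-- `⋃_{i ∈ S} Q[i]`: the objects isomorphic to `X[i]` for some `X ∈ Q` and `i ∈ S`. -/
def shifts (Q : ObjectProperty C) (S : Set ℤ) : ObjectProperty C :=
  fun Y => ∃ i ∈ S, ∃ X : C, Q X ∧ Nonempty (Y ≅ X⟦i⟧)

/-- The objects of the localizing subcategory generated by `Q`. -/
def localizingClosure (Q : ObjectProperty C) : ObjectProperty C :=
  extCoprodClosure (shifts Q Set.univ)

/-- The class `Q` is connective: `Q ⊥ ⋃_{i > 0} Q[i]`. -/
def IsConnective (Q : ObjectProperty C) : Prop :=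
  ∀ ⦃X Y : C⦄, Q X → Q Y → ∀ i : ℤ, 0 < i → ∀ f : X ⟶ Y⟦i⟧, f = 0

section Generation

variable [HasCoproducts.{v} C]

/-- `C` is `α`-well generated by the set `{p i}`. -/
def IsWellGeneratedBy (α : Cardinal.{v}) {ι : Type v} (p : ι → C) : Prop :=
  IsPerfect α p ∧ localizingClosure (ObjectProperty.ofObj p) = ⊤

/-- `C` is compactly generated by the set `{p i}`. -/
def IsCompactlyGeneratedBy {ι : Type v} (p : ι → C) : Prop :=
  IsWellGeneratedBy ℵ₀ p

variable (C) in
/-- `C` is well generated. -/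
def IsWellGenerated : Prop :=
  ∃ (α : Cardinal.{v}) (ι : Type v) (p : ι → C), IsWellGeneratedBy α p

end Generation

variable (C) in
/-- A weight structure `w` on `C`; `le` is the class `C_{w ≤ 0}` and `ge` is the class
`C_{w ≥ 0}`. (In a triangulated category the direct summands of an object are its retracts.) -/
structure WeightStructure where
  le : ObjectProperty C
  ge : ObjectProperty C
  le_retract : le.IsStableUnderRetracts
  ge_retract : ge.IsStableUnderRetracts
  /-- `C_{w ≤ 0} ⊆ C_{w ≤ 0}[1]` -/
  le_shift (X : C) (hX : le X) : le (X⟦(-1 : ℤ)⟧)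
  /-- `C_{w ≥ 0}[1] ⊆ C_{w ≥ 0}` -/
  ge_shift (X : C) (hX : ge X) : ge (X⟦(1 : ℤ)⟧)
  /-- `C_{w ≤ 0} ⊥ C_{w ≥ 0}[1]` -/
  orthogonal ⦃X Y : C⦄ (hX : le X) (hY : ge Y) (f : X ⟶ Y⟦(1 : ℤ)⟧) : f = 0
  /-- Weight decompositions `L ⟶ M ⟶ R[1] ⟶ L[1]`, with `L ∈ C_{w ≤ 0}` and `R ∈ C_{w ≥ 0}`. -/
  exists_decomposition (M : C) : ∃ (L R : C) (_ : le L) (_ : ge R) (f : L ⟶ M)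
    (g : M ⟶ R⟦(1 : ℤ)⟧) (h : R⟦(1 : ℤ)⟧ ⟶ L⟦(1 : ℤ)⟧), Triangle.mk f g h ∈ distTriang C

namespace WeightStructure

variable (w : WeightStructure C)

/-- The class `C_{w = 0}` of objects of the heart `Hw`. -/
def heart : ObjectProperty C := w.ge ⊓ w.le

/-- `w` is smashing: `C` has small coproducts and `C_{w ≥ 0}` is closed under them. -/
def IsSmashing : Prop :=
  HasCoproducts.{v} C ∧ ∀ I : Type v, w.ge.IsClosedUnderColimitsOfShape (Discrete I)

/-- The class `Q` class-generates `w`. -/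
def IsClassGeneratedBy (Q : ObjectProperty C) : Prop :=
  HasCoproducts.{v} C ∧ w.ge = extCoprodClosure (shifts Q {i | 0 ≤ i}) ∧
    w.le = extCoprodClosure (shifts Q {i | i ≤ 0})

/-- `w` and the t-structure `t` are adjacent: `C_{w ≥ 0} = C_{t ≥ 0}`. Here `C_{t ≥ 0}` is written
in the homological convention; in the cohomological convention of `TStructure` it is the class
`t.le 0` (and the homological `C_{t ≤ 0}` is `t.ge 0`). -/
def IsAdjacent (t : TStructure C) : Prop := w.ge = t.le 0

end WeightStructure

/-- The category of projective left `R`-modules. -/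
abbrev ProjMod (R : Type v) [Ring R] :=
  ObjectProperty.FullSubcategory (fun M : ModuleCat.{v} R => Module.Projective R M)

end WeightT

end

/-!
Compactness and connectivity of `P` make the closure of `{P[i] : i > n}` right orthogonal to that of
`{P[i] : i ≤ n}`. Therefore extensions of an object of the first closure by one of the second are
again stable under extensions and coproducts, and since `P` generates, every object is of this form:
this is the weight decomposition. Stability under direct summands is Eilenberg's swindle.

The truncations of the t-structure come from the cellular construction familiar from Brown
representability: starting from a coproduct of generators mapping onto all morphisms from the
generators to `M`, one repeatedly attaches cells to kill the kernel, and compactness shows that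
the homotopy colimit has a cone orthogonal to the generators.

Every `X` in `C_{w ≥ 0}` has a morphism from some `∐ P` whose cone lies in `C_{w ≥ 1}`. If `X` is in
the heart of `w`, this morphism splits, and the weight heart is identified with the projective
modules because `Hom(P, ∐_I P)` is free on `I`. If `X` is in the heart of `t`, the same morphism
shows that `Hom(P, -)` is fully faithful on the heart; it is essentially surjective because the
cone of a presentation `∐_J P ⟶ ∐_I P` of a module has `Hom(P, -)` equal to that module, which
the truncation to the heart preserves.
-/

noncomputable section

namespace WeightT

attribute [local instance] has_smallest_coproducts_of_hasCoproducts

section CompactObject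

variable {C : Type u} [Category.{v} C] [Preadditive C]

/-- `K` is a compact object: every morphism from `K` to a small coproduct is a finite sum of
morphisms that factor through the summands. -/
def IsCompactObject (K : C) : Prop :=
  ∀ ⦃I : Type v⦄ (N : I → C) (c : Cofan N), IsColimit c → ∀ x : K ⟶ c.pt,
    ∃ (s : Finset I) (y : ∀ i, K ⟶ N i), x = ∑ i ∈ s, y i ≫ c.inj i

namespace IsCompactObject

lemma of_adjunction {F G : C ⥤ C} (adj : F ⊣ G) [F.Additive] [G.Additive]
    [∀ I : Type v, PreservesColimitsOfShape (Discrete I) G] {K : C} (hK : IsCompactObject K) :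
    IsCompactObject (F.obj K) := by
  intro I N c hc x
  obtain ⟨s, y, hy⟩ := hK _ _ (Cofan.isColimitMapCoconeEquiv G N c (isColimitOfPreserves G hc))
    (adj.homEquiv _ _ x)
  refine ⟨s, fun i => (adj.homEquiv _ _).symm (y i), (adj.homEquiv _ _).injective ?_⟩
  rw [hy, ← Adjunction.homAddEquiv_apply, map_sum]
  refine Finset.sum_congr rfl fun i _ => ?_
  rw [Adjunction.homAddEquiv_apply, adj.homEquiv_naturality_right]
  simp

lemma of_iso {K K' : C} (e : K ≅ K') (hK : IsCompactObject K) : IsCompactObject K' := by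
  intro I N c hc x
  obtain ⟨s, y, hy⟩ := hK N c hc (e.hom ≫ x)
  refine ⟨s, fun i => e.inv ≫ y i, ?_⟩
  rw [← cancel_epi e.hom, hy, Preadditive.comp_sum]
  simp

lemma shift [HasShift C ℤ] [∀ n : ℤ, (shiftFunctor C n).Additive] {K : C}
    (hK : IsCompactObject K) (n : ℤ) : IsCompactObject (K⟦n⟧) :=
  hK.of_adjunction (F := shiftFunctor C n) (G := shiftFunctor C (-n))
    (shiftEquiv' C n (-n) (by simp)).toAdjunction

lemma exists_eq_sum {K : C} (hK : IsCompactObject K) {I : Type*} [Small.{v} I] {N : I → C}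
    [HasCoproduct N] (x : K ⟶ ∐ N) :
    ∃ (s : Finset I) (y : ∀ i, K ⟶ N i), x = ∑ i ∈ s, y i ≫ Sigma.ι N i := by
  let e := (equivShrink I).symm
  obtain ⟨s, y, hy⟩ := hK _ (Cofan.mk (∐ N) fun i => Sigma.ι N (e i))
    ((coproductIsCoproduct N).whiskerEquivalence (Discrete.equivalence e)) x
  refine ⟨s.map e.toEmbedding, Equiv.piCongrLeft (fun i => K ⟶ N i) e y, ?_⟩
  rw [Finset.sum_map]
  refine hy.trans (Finset.sum_congr rfl fun i _ => ?_)
  rw [Equiv.toEmbedding_apply, Equiv.piCongrLeft_apply_apply]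
  rfl

lemma eq_zero_of_comp_π {K : C} (hK : IsCompactObject K) {I : Type*} [Small.{v} I] [DecidableEq I]
    {N : I → C} [HasCoproduct N] (x : K ⟶ ∐ N) (hx : ∀ i, x ≫ Sigma.π N i = 0) : x = 0 := by
  obtain ⟨s, y, rfl⟩ := hK.exists_eq_sum x
  refine Finset.sum_eq_zero fun j hj => ?_
  have hy : y j = 0 := by
    rw [← hx j, Preadditive.sum_comp, Finset.sum_eq_single_of_mem j hj]
    · simp
    · intro i _ hij
      rw [Category.assoc, Sigma.ι_π_of_ne _ hij, comp_zero]
  rw [hy, zero_comp]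

end IsCompactObject

lemma sum_π_comp_ι {I : Type*} [Fintype I] [DecidableEq I] (N : I → C) [HasCoproduct N] :
    ∑ i, Sigma.π N i ≫ Sigma.ι N i = 𝟙 (∐ N) := by
  refine Sigma.hom_ext _ _ fun j => ?_
  rw [Preadditive.comp_sum, Finset.sum_eq_single j _ (by simp), Sigma.ι_π_eq_id_assoc,
    Category.comp_id]
  intro i _ hij
  rw [Sigma.ι_π_of_ne_assoc _ hij.symm, zero_comp]

variable [HasCoproducts.{v} C]

instance isFiltered_finite_subsets (I : Type v) : IsFiltered {J : Set I // #J < ℵ₀} :=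
  have : Nonempty {J : Set I // #J < ℵ₀} := ⟨⟨∅, by simp [Cardinal.aleph0_pos]⟩⟩
  have : IsDirectedOrder {J : Set I // #J < ℵ₀} := ⟨fun J J' =>
    ⟨⟨J.1 ∪ J'.1, (Cardinal.mk_union_le _ _).trans_lt (Cardinal.add_lt_aleph0 J.2 J'.2)⟩,
      Set.subset_union_left, Set.subset_union_right⟩⟩
  isFiltered_of_directed_le_nonempty _

lemma IsPerfect.exists_factor_finite {ι : Type v} {p : ι → C} (hp : IsPerfect ℵ₀ p) (i : ι)
    {I : Type v} {N : I → C} (x : p i ⟶ ∐ N) :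
    ∃ (J : Set I) (_ : J.Finite) (y : p i ⟶ ∐ fun j : J => N j.1),
      y ≫ Sigma.desc (fun j : J => Sigma.ι N j.1) = x := by
  classical
  let F (i : ι) := preadditiveCoyoneda.obj (op (p i))
  obtain ⟨hc⟩ := hp.isColimit N
  obtain ⟨J, y, hy⟩ := Concrete.isColimit_exists_rep _ hc ((Sigma.ι F i).app _ x)
  refine ⟨J.1, Cardinal.lt_aleph0_iff_set_finite.1 J.2, (Sigma.π F i).app _ y, ?_⟩
  have h : (Sigma.ι F i).app (∐ N) ≫ (Sigma.π F i).app (∐ N) = 𝟙 _ := by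
    rw [← NatTrans.comp_app, Sigma.ι_π_eq_id, NatTrans.id_app]
  exact ((NatTrans.naturality_apply (Sigma.π F i) _ y).symm.trans (congrArg _ hy)).trans
    (ConcreteCategory.congr_hom h x)

lemma IsPerfect.isCompactObject {ι : Type v} {p : ι → C} (hp : IsPerfect ℵ₀ p) (i : ι) :
    IsCompactObject (p i) := by
  classical
  intro I N c hc x
  let e := hc.coconePointUniqueUpToIso (coproductIsCoproduct N)
  have he (j : I) : Sigma.ι N j ≫ e.inv = c.inj j :=
    hc.comp_coconePointUniqueUpToIso_inv (coproductIsCoproduct N) ⟨j⟩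
  obtain ⟨J, hJ, y, hy⟩ := hp.exists_factor_finite i (x ≫ e.hom)
  have := hJ.fintype
  refine ⟨Finset.univ.map (Function.Embedding.subtype (· ∈ J)), fun j => if h : j ∈ J then
    y ≫ Sigma.π (fun j : J => N j.1) ⟨j, h⟩ else 0, ?_⟩
  calc
    x = y ≫ Sigma.desc (fun j : J => Sigma.ι N j.1) ≫ e.inv := by simp [reassoc_of% hy]
    _ = ∑ j : J, (y ≫ Sigma.π (fun j : J => N j.1) j) ≫ c.inj j := by
      rw [← Category.id_comp (Sigma.desc _ ≫ _), ← sum_π_comp_ι, Preadditive.sum_comp,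
        Preadditive.comp_sum]
      simp [he]
    _ = _ := by
      rw [Finset.sum_map]
      exact Finset.sum_congr rfl fun j _ => by simp

end CompactObject

section Swindle

variable {C : Type u} [Category.{v} C] [Preadditive C]

/-- The morphism `u` splits off the image of `e` from a countable coproduct of copies of `Y`: it
moves the image of `e` in each summand one step to the right and is the identity on the kernel. -/
lemma exists_swindle {Y : C} [HasCoproduct fun _ : ℕ => Y] {e : Y ⟶ Y} (he : e ≫ e = e) :
    ∃ (u r : (∐ fun _ : ℕ => Y) ⟶ ∐ fun _ : ℕ => Y) (q : (∐ fun _ : ℕ => Y) ⟶ Y),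
      u ≫ r = 𝟙 _ ∧ r ≫ u + q ≫ Sigma.ι (fun _ : ℕ => Y) 0 = 𝟙 _ ∧ u ≫ q = 0 ∧
        Sigma.ι (fun _ : ℕ => Y) 0 ≫ q = e := by
  let ι := Sigma.ι (fun _ : ℕ => Y)
  let u : (∐ fun _ : ℕ => Y) ⟶ ∐ fun _ : ℕ => Y :=
    Sigma.desc fun n => (𝟙 _ - e) ≫ ι n + e ≫ ι (n + 1)
  let r : (∐ fun _ : ℕ => Y) ⟶ ∐ fun _ : ℕ => Y :=
    Sigma.desc fun n => (𝟙 _ - e) ≫ ι n + Nat.casesOn n 0 fun m => e ≫ ι m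
  let q : (∐ fun _ : ℕ => Y) ⟶ Y := Sigma.desc fun n => Nat.casesOn n e fun _ => 0
  refine ⟨u, r, q, Sigma.hom_ext _ _ fun n => ?_, Sigma.hom_ext _ _ fun n => ?_,
    Sigma.hom_ext _ _ fun n => ?_, by simp [q]⟩
  · cases n <;> simp [u, r, ι, reassoc_of% he]
  · cases n <;> simp [u, r, q, ι, reassoc_of% he]
  · cases n <;> simp [u, q, ι, he]

/-- Eilenberg's swindle. -/
lemma nonempty_biprod_iso_of_retract {X Y : C} [HasCoproduct fun _ : ℕ => Y]
    [HasBinaryBiproducts C] (h : Retract X Y) :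
    Nonempty (X ⊞ (∐ fun _ : ℕ => Y) ≅ ∐ fun _ : ℕ => Y) := by
  obtain ⟨u, r, q, hur, hru, huq, hq⟩ := exists_swindle (e := h.r ≫ h.i) (by simp)
  let j := Sigma.ι (fun _ : ℕ => Y) 0
  have hu : Mono u := mono_of_mono_fac hur
  have hj : h.i ≫ j ≫ r = 0 := by
    rw [← cancel_mono u]
    simpa [reassoc_of% hq, j] using (h.i ≫ j) ≫= hru
  refine ⟨⟨biprod.desc (h.i ≫ j) u, biprod.lift (q ≫ h.r) r, ?_, ?_⟩⟩
  · ext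
    · simp [j, reassoc_of% hq]
    · simp [hj]
    · simp [reassoc_of% huq]
    · simp [hur]
  · have hqe : q ≫ h.r ≫ h.i = q := by
      have := hru =≫ q
      simpa [huq, hq] using this
    rw [biprod.lift_desc, add_comm, Category.assoc, reassoc_of% hqe]
    exact hru

end Swindle

section Triangles

variable {C : Type u} [Category.{v} C] [Preadditive C] [HasZeroObject C] [HasShift C ℤ]
  [∀ n : ℤ, (shiftFunctor C n).Additive] [Pretriangulated C]

lemma isIdempotentComplete_of_hasCountableCoproducts [HasCoproductsOfShape ℕ C] :
    IsIdempotentComplete C := by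
  refine ⟨fun Y e he => ?_⟩
  obtain ⟨u, r, q, hur, hru, huq, hq⟩ := exists_swindle he
  obtain ⟨X, g, h, hX⟩ := distinguished_cocone_triangle u
  have hu : Mono u := mono_of_mono_fac hur
  obtain rfl : h = 0 := Triangle.mor₃_eq_zero_of_mono₁ _ hX hu
  have hg : Epi g := Triangle.epi₂ _ hX rfl
  have hug : u ≫ g = 0 := comp_distTriang_mor_zero₁₂ _ hX
  obtain ⟨i, hi⟩ : ∃ i, q = g ≫ i := Triangle.yoneda_exact₂ _ hX q huq
  refine ⟨X, i, Sigma.ι (fun _ : ℕ => Y) 0 ≫ g, ?_, by rw [Category.assoc, ← hi, hq]⟩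
  rw [← cancel_epi g, ← Category.assoc, ← hi, Category.comp_id]
  simpa [hug] using hru =≫ g

lemma exists_distTriang_of_iso {T : Triangle C} (hT : T ∈ distTriang C) {X₁ X₂ X₃ : C}
    (e₁ : T.obj₁ ≅ X₁) (e₂ : T.obj₂ ≅ X₂) (e₃ : T.obj₃ ≅ X₃) :
    ∃ (f : X₁ ⟶ X₂) (g : X₂ ⟶ X₃) (h : X₃ ⟶ X₁⟦(1 : ℤ)⟧), Triangle.mk f g h ∈ distTriang C :=
  ⟨e₁.inv ≫ T.mor₁ ≫ e₂.hom, e₂.inv ≫ T.mor₂ ≫ e₃.hom, e₃.inv ≫ T.mor₃ ≫ e₁.hom⟦1⟧',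
    isomorphic_distinguished T hT _ (Triangle.isoMk _ _ e₁.symm e₂.symm e₃.symm
      (by change (e₁.inv ≫ T.mor₁ ≫ e₂.hom) ≫ e₂.inv = e₁.inv ≫ T.mor₁; simp)
      (by change (e₂.inv ≫ T.mor₂ ≫ e₃.hom) ≫ e₃.inv = e₂.inv ≫ T.mor₂; simp)
      (by
        change (e₃.inv ≫ T.mor₃ ≫ e₁.hom⟦1⟧') ≫ e₁.inv⟦1⟧' = e₃.inv ≫ T.mor₃
        simp [← Functor.map_comp]))⟩

/-- Coproducts of triangles are products of triangles in `Cᵒᵖ`. -/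
lemma exists_distTriang_sigma {I : Type*} [HasCoproductsOfShape I C] {T : I → Triangle C}
    (hT : ∀ i, T i ∈ distTriang C) :
    ∃ (f : (∐ fun i => (T i).obj₁) ⟶ ∐ fun i => (T i).obj₂)
      (g : (∐ fun i => (T i).obj₂) ⟶ ∐ fun i => (T i).obj₃)
      (h : (∐ fun i => (T i).obj₃) ⟶ (∐ fun i => (T i).obj₁)⟦(1 : ℤ)⟧),
      Triangle.mk f g h ∈ distTriang C :=
  exists_distTriang_of_iso (unop_distinguished _ (productTriangle_distinguished
      (fun i => (triangleOpEquivalence C).functor.obj (op (T i)))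
      fun i => op_distinguished _ (hT i)))
    (opCoproductIsoProduct fun i => (T i).obj₁).unop
    (opCoproductIsoProduct fun i => (T i).obj₂).unop
    (opCoproductIsoProduct fun i => (T i).obj₃).unop

end Triangles

section HomotopyColimit

variable {C : Type u} [Category.{v} C] {A : ℕ → C}

lemma exists_eq_comp_of_le {t : ∀ n, A n ⟶ A (n + 1)} {X W : C} {a : ∀ n, A n ⟶ X}
    (ha : ∀ n, t n ≫ a (n + 1) = a n) {m n : ℕ} (hmn : m ≤ n) (y : W ⟶ A m) :
    ∃ z : W ⟶ A n, y ≫ a m = z ≫ a n := by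
  induction n, hmn using Nat.le_induction with
  | base => exact ⟨y, rfl⟩
  | succ n _ ih =>
    obtain ⟨z, hz⟩ := ih
    exact ⟨z ≫ t n, by rw [hz, Category.assoc, ha]⟩

variable [Preadditive C] [HasCoproduct A]

/-- The telescope map of a sequence of morphisms; its cone is the homotopy colimit of the
sequence. -/
def telescope (t : ∀ n, A n ⟶ A (n + 1)) : ∐ A ⟶ ∐ A :=
  Sigma.desc fun n => Sigma.ι A n - t n ≫ Sigma.ι A (n + 1)

variable (t : ∀ n, A n ⟶ A (n + 1))

lemma ι_telescope (n : ℕ) :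
    Sigma.ι A n ≫ telescope t = Sigma.ι A n - t n ≫ Sigma.ι A (n + 1) := by
  simp [telescope]

lemma telescope_π_zero : telescope t ≫ Sigma.π A 0 = Sigma.π A 0 :=
  Sigma.hom_ext _ _ fun m => by
    rw [reassoc_of% ι_telescope t, Preadditive.sub_comp, Category.assoc,
      Sigma.ι_π_of_ne _ m.succ_ne_zero, comp_zero, sub_zero]

lemma telescope_π_succ (n : ℕ) :
    telescope t ≫ Sigma.π A (n + 1) = Sigma.π A (n + 1) - Sigma.π A n ≫ t n :=
  Sigma.hom_ext _ _ fun m => by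
    rw [reassoc_of% ι_telescope t, Preadditive.sub_comp, Category.assoc, Preadditive.comp_sub]
    congr 1
    by_cases hmn : m = n
    · subst hmn
      simp
    · rw [Sigma.ι_π_of_ne _ (by simpa using hmn), Sigma.ι_π_of_ne_assoc _ hmn, comp_zero, zero_comp]

variable {t}

lemma IsCompactObject.eq_zero_of_comp_telescope {K : C} (hK : IsCompactObject K) {x : K ⟶ ∐ A}
    (hx : x ≫ telescope t = 0) : x = 0 := by
  refine hK.eq_zero_of_comp_π x fun n => ?_
  induction n with
  | zero => rw [← telescope_π_zero t, reassoc_of% hx, zero_comp]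
  | succ n ih =>
    have := hx =≫ Sigma.π A (n + 1)
    rwa [Category.assoc, telescope_π_succ, Preadditive.comp_sub, reassoc_of% ih, zero_comp,
      zero_comp, sub_zero] at this

variable [HasZeroObject C] [HasShift C ℤ]
  [∀ n : ℤ, (shiftFunctor C n).Additive] [Pretriangulated C]
  {H : C} {g : ∐ A ⟶ H} {h : H ⟶ (∐ A)⟦(1 : ℤ)⟧}

lemma comp_ι_comp_telescopeCone (hT : Triangle.mk (telescope t) g h ∈ distTriang C) (n : ℕ) :
    t n ≫ Sigma.ι A (n + 1) ≫ g = Sigma.ι A n ≫ g := by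
  have : telescope t ≫ g = 0 := comp_distTriang_mor_zero₁₂ _ hT
  have := Sigma.ι A n ≫= this
  rw [reassoc_of% ι_telescope t, comp_zero, Preadditive.sub_comp, sub_eq_zero] at this
  simpa using this.symm

lemma exists_telescopeCone_desc (hT : Triangle.mk (telescope t) g h ∈ distTriang C) {X : C}
    {a : ∀ n, A n ⟶ X} (ha : ∀ n, t n ≫ a (n + 1) = a n) :
    ∃ k : H ⟶ X, ∀ n, Sigma.ι A n ≫ g ≫ k = a n := by
  have hd : telescope t ≫ Sigma.desc a = 0 := Sigma.hom_ext _ _ fun n => by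
    simp [reassoc_of% ι_telescope t, ha]
  obtain ⟨k, hk⟩ : ∃ k, Sigma.desc a = g ≫ k := Triangle.yoneda_exact₂ _ hT _ hd
  exact ⟨k, fun n => by rw [← hk, Sigma.ι_desc]⟩

lemma IsCompactObject.exists_eq_comp_of_telescopeCone {K : C} (hK : IsCompactObject K)
    (hT : Triangle.mk (telescope t) g h ∈ distTriang C) (x : K ⟶ H) :
    ∃ (n : ℕ) (y : K ⟶ A n), x = y ≫ Sigma.ι A n ≫ g := by
  have hxh : x ≫ h = 0 := by
    let e := shiftNegShift K (1 : ℤ)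
    obtain ⟨z, hz⟩ := (shiftFunctor C (1 : ℤ)).map_surjective (e.hom ≫ x ≫ h)
    have : h ≫ (telescope t)⟦(1 : ℤ)⟧' = 0 := comp_distTriang_mor_zero₃₁ _ hT
    have hz₀ : z = 0 := (hK.shift (-1)).eq_zero_of_comp_telescope (t := t)
      ((shiftFunctor C (1 : ℤ)).map_injective (by simp [hz, this]))
    rw [← cancel_epi e.hom, ← hz, hz₀, Functor.map_zero, comp_zero]
  obtain ⟨y, rfl⟩ : ∃ y, x = y ≫ g := Triangle.coyoneda_exact₃ _ hT x hxh
  obtain ⟨s, z, rfl⟩ := hK.exists_eq_sum y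
  choose w hw using fun i : s => exists_eq_comp_of_le (a := fun n => Sigma.ι A n ≫ g)
    (comp_ι_comp_telescopeCone hT) (Finset.le_sup (f := id) i.2) (z i)
  refine ⟨s.sup id, ∑ i, w i, ?_⟩
  rw [Preadditive.sum_comp, Preadditive.sum_comp, ← s.sum_attach]
  exact Finset.sum_congr rfl fun i _ => (Category.assoc _ _ _).trans (hw i)

end HomotopyColimit

section Closure

variable {C : Type u} [Category.{v} C] [Preadditive C] [HasZeroObject C] [HasShift C ℤ]
  [∀ n : ℤ, (shiftFunctor C n).Additive] [Pretriangulated C] {Q Q' : ObjectProperty C}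

instance : (extCoprodClosure Q).IsClosedUnderIsomorphisms where
  of_iso {X Y} e hX := .coproduct (I := PUnit) (fun _ => X) (Cofan.mk Y fun _ => e.hom)
    (Cofan.isColimitMkOfUnique e _) fun _ => hX

instance (I : Type v) : (extCoprodClosure Q).IsClosedUnderColimitsOfShape (Discrete I) where
  colimitsOfShape_le := by
    rintro X ⟨h⟩
    exact .coproduct _ ((Cocone.precompose Discrete.natIsoFunctor.inv).obj h.cocone)
      ((IsColimit.precomposeInvEquiv _ _).symm h.isColimit) fun i => h.prop_diag_obj ⟨i⟩

instance : (extCoprodClosure Q).IsTriangulatedClosed₂ := .mk' .extension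

instance : (extCoprodClosure Q).ContainsZero where
  exists_zero := ⟨_, isZero_zero C, .coproduct (I := PEmpty) PEmpty.elim
    (Cofan.mk _ fun i => i.elim) (Cofan.IsColimit.mk _ (fun _ => 0) (fun _ i => i.elim)
      fun _ _ _ => (isZero_zero C).eq_of_src _ _) fun i => i.elim⟩

lemma le_extCoprodClosure : Q ≤ extCoprodClosure Q := .of

lemma extCoprodClosure_le [Q'.IsTriangulatedClosed₂] [Q'.IsClosedUnderIsomorphisms]
    (hcoprod : ∀ ⦃I : Type v⦄ (N : I → C) (c : Cofan N), IsColimit c → (∀ i, Q' (N i)) → Q' c.pt)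
    (h : Q ≤ Q') : extCoprodClosure Q ≤ Q' := by
  intro X hX
  induction hX with
  | of X hX => exact h X hX
  | coproduct N c hc _ ih => exact hcoprod N c hc ih
  | extension T hT _ _ ih₁ ih₃ => exact Q'.ext_of_isTriangulatedClosed₂ T hT ih₁ ih₃

lemma extCoprodClosure_le_iff :
    extCoprodClosure Q ≤ extCoprodClosure Q' ↔ Q ≤ extCoprodClosure Q' :=
  ⟨le_extCoprodClosure.trans, extCoprodClosure_le fun _ => .coproduct⟩

lemma extCoprodClosure_mono (h : Q ≤ Q') : extCoprodClosure Q ≤ extCoprodClosure Q' :=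
  extCoprodClosure_le_iff.2 (h.trans le_extCoprodClosure)

lemma extCoprodClosure_shift {n : ℤ} (h : Q ≤ Q'.shift n) :
    extCoprodClosure Q ≤ (extCoprodClosure Q').shift n := by
  have : ((extCoprodClosure Q').shift n).IsTriangulatedClosed₂ := .mk' fun T hT h₁ h₃ =>
    .extension _ (Triangle.shift_distinguished T hT n) h₁ h₃
  exact extCoprodClosure_le (fun I N c hc hN => .coproduct _ _
    (Cofan.isColimitMapCoconeEquiv (shiftFunctor C n) N c (isColimitOfPreserves _ hc)) hN)
    fun X hX => le_extCoprodClosure _ (h X hX)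

lemma rightOrthogonal_extCoprodClosure :
    (extCoprodClosure Q).rightOrthogonal = Q.rightOrthogonal := by
  refine le_antisymm (fun Y hY X f hX => hY f (le_extCoprodClosure X hX)) fun Y hY X f hX => ?_
  have h : Q ≤ (ObjectProperty.singleton Y).leftOrthogonal := by
    rintro X hX Z f hZ
    obtain rfl : Y = Z := by simpa using hZ
    exact hY f hX
  refine extCoprodClosure_le (fun I N c hc hN Z f hZ => ?_) h X hX f (by simp)
  exact Cofan.IsColimit.hom_ext hc _ _ fun i => by rw [hN i (c.inj i ≫ f) hZ, comp_zero]

lemma extCoprodClosure_le_rightOrthogonal (hQ : Q ≤ IsCompactObject)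
    (h : Q' ≤ Q.rightOrthogonal) : extCoprodClosure Q' ≤ Q.rightOrthogonal := by
  refine extCoprodClosure_le (fun I N c hc hN X f hX => ?_) h
  obtain ⟨s, y, rfl⟩ := hQ X hX N c hc f
  exact Finset.sum_eq_zero fun i _ => by rw [hN i (y i) hX, zero_comp]

lemma extCoprodClosure.sigma {I : Type*} [Small.{v} I] [HasCoproductsOfShape I C] {N : I → C}
    (h : ∀ i, extCoprodClosure Q (N i)) : extCoprodClosure Q (∐ N) :=
  let e := (equivShrink I).symm
  .coproduct _ (Cofan.mk (∐ N) fun i => Sigma.ι N (e i))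
    ((coproductIsCoproduct N).whiskerEquivalence (Discrete.equivalence e)) fun i => h (e i)

variable [HasCoproductsOfShape ℕ C]

lemma isStableUnderRetracts_of_shift_one [(extCoprodClosure Q).IsStableUnderShiftBy (1 : ℤ)] :
    (extCoprodClosure Q).IsStableUnderRetracts where
  of_retract {X Y} r hY := by
    obtain ⟨e⟩ := nonempty_biprod_iso_of_retract r
    have hS : extCoprodClosure Q (∐ fun _ : ℕ => Y) := .sigma fun _ => hY
    exact .extension _ (rot_of_distTriang _
      (binaryBiproductTriangle_distinguished (∐ fun _ : ℕ => Y) X))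
      (ObjectProperty.prop_of_iso _ (e.symm ≪≫ biprod.braiding _ _) hS)
      (ObjectProperty.le_shift _ 1 _ hS)

lemma isStableUnderRetracts_of_shift_neg_one
    [(extCoprodClosure Q).IsStableUnderShiftBy (-1 : ℤ)] :
    (extCoprodClosure Q).IsStableUnderRetracts where
  of_retract {X Y} r hY := by
    obtain ⟨e⟩ := nonempty_biprod_iso_of_retract r
    have hS : extCoprodClosure Q (∐ fun _ : ℕ => Y) := .sigma fun _ => hY
    exact .extension _ (inv_rot_of_distTriang _
      (binaryBiproductTriangle_distinguished X (∐ fun _ : ℕ => Y)))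
      (ObjectProperty.le_shift _ (-1) _ hS) (ObjectProperty.prop_of_iso _ e.symm hS)

end Closure

section Shifts

variable {C : Type u} [Category.{v} C] [HasShift C ℤ] {Q : ObjectProperty C} {S S' : Set ℤ}

instance : (shifts Q S).IsClosedUnderIsomorphisms where
  of_iso := by
    rintro X Y e ⟨i, hi, Z, hZ, ⟨e'⟩⟩
    exact ⟨i, hi, Z, hZ, ⟨e.symm ≪≫ e'⟩⟩

lemma shifts_le_iff {Q' : ObjectProperty C} [Q'.IsClosedUnderIsomorphisms] :
    shifts Q S ≤ Q' ↔ ∀ i ∈ S, Q ≤ Q'.shift i := by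
  refine ⟨fun h i hi X hX => h _ ⟨i, hi, X, hX, ⟨Iso.refl _⟩⟩, ?_⟩
  rintro h X ⟨i, hi, Y, hY, ⟨e⟩⟩
  exact Q'.prop_of_iso e.symm (h i hi Y hY)

lemma le_shift_shifts {i : ℤ} (hi : i ∈ S) : Q ≤ (shifts Q S).shift i :=
  shifts_le_iff.1 le_rfl i hi

lemma le_shifts (h : 0 ∈ S) : Q ≤ shifts Q S := fun X hX =>
  (shifts Q S).prop_of_iso ((shiftFunctorZero C ℤ).app X) (le_shift_shifts h X hX)

lemma shifts_mono (h : S ⊆ S') : shifts Q S ≤ shifts Q S' :=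
  shifts_le_iff.2 fun _ hi => le_shift_shifts (h hi)

lemma shifts_le_shift {n : ℤ} (h : ∀ i ∈ S, i + n ∈ S') : shifts Q S ≤ (shifts Q S').shift n :=
  shifts_le_iff.2 fun i hi => by
    rw [ObjectProperty.shift_shift _ i n (i + n) rfl]
    exact le_shift_shifts (h i hi)

lemma shifts_union : shifts Q (S ∪ S') = shifts Q S ⊔ shifts Q S' := by
  ext X
  simp only [shifts, Set.mem_union, or_and_right, exists_or]
  rfl

variable [Preadditive C] [∀ n : ℤ, (shiftFunctor C n).Additive]

lemma shifts_le_isCompactObject (hQ : Q ≤ IsCompactObject) : shifts Q S ≤ IsCompactObject := by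
  rintro X ⟨i, -, Y, hY, ⟨e⟩⟩
  exact ((hQ Y hY).shift i).of_iso e.symm

lemma IsConnective.shifts_le_rightOrthogonal [HasZeroObject C] [Pretriangulated C]
    (hQ : IsConnective Q) (h : ∀ i ∈ S, ∀ j ∈ S', i < j) :
    shifts Q S' ≤ (shifts Q S).rightOrthogonal := by
  refine shifts_le_iff.2 fun j hj Y hY => ?_
  rintro X f ⟨i, hi, X, hX, ⟨e⟩⟩
  obtain ⟨g, hg⟩ := (shiftFunctor C i).map_surjective
    (e.inv ≫ f ≫ ((shiftFunctorAdd' C (j - i) i j (by lia)).app Y).hom)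
  rw [← cancel_mono ((shiftFunctorAdd' C (j - i) i j (by lia)).app Y).hom, ← cancel_epi e.inv,
    ← hg, hQ hX hY (j - i) (by grind) g]
  simp

end Shifts

section ExtensionProduct

open ObjectProperty

variable {C : Type u} [Category.{v} C] [Preadditive C] [HasZeroObject C] [HasShift C ℤ]
  [∀ n : ℤ, (shiftFunctor C n).Additive] [Pretriangulated C] {Q R : ObjectProperty C}

lemma extensionProduct_le_swap (h : R ≤ Q.rightOrthogonal.shift (1 : ℤ)) :
    extensionProduct R Q ≤ extensionProduct Q R := by
  rintro X ⟨Y, Z, f, g, k, hT, hY, hZ⟩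
  obtain ⟨e, -⟩ := exists_iso_binaryBiproduct_of_distTriang _ hT (h Y hY k hZ)
  exact (extensionProduct Q R).prop_of_iso (biprod.braiding Z Y ≪≫ e.symm)
    ⟨_, _, _, _, _, binaryBiproductTriangle_distinguished Z Y, hZ, hY⟩

/-- The product of classes under extensions is associative, so `(Q * R) * (Q * R)` can be
rearranged to `(Q * Q) * (R * R)` as soon as `R * Q ≤ Q * R`. -/
lemma isTriangulatedClosed₂_extensionProduct [IsTriangulated C] [Q.IsTriangulatedClosed₂]
    [Q.IsClosedUnderIsomorphisms] [R.IsTriangulatedClosed₂] [R.IsClosedUnderIsomorphisms]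
    (h : R ≤ Q.rightOrthogonal.shift (1 : ℤ)) : (extensionProduct Q R).IsTriangulatedClosed₂ := by
  suffices extensionProduct (extensionProduct Q R) (extensionProduct Q R) ≤ extensionProduct Q R
    from .mk' fun T hT h₁ h₃ => this _ ⟨_, _, _, _, _, hT, h₁, h₃⟩
  calc
    extensionProduct (extensionProduct Q R) (extensionProduct Q R)
      = extensionProduct Q (extensionProduct (extensionProduct R Q) R) := by
        simp only [extensionProduct_assoc]
    _ ≤ extensionProduct Q (extensionProduct (extensionProduct Q R) R) :=
        monotone_extensionProduct_right _
          (monotone_extensionProduct_left _ (extensionProduct_le_swap h))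
    _ = extensionProduct (extensionProduct Q Q) (extensionProduct R R) := by
        simp only [extensionProduct_assoc]
    _ ≤ extensionProduct Q (extensionProduct R R) := monotone_extensionProduct_left _
        (extensionProduct_le_of_isTriangulatedClosed₂ le_rfl le_rfl)
    _ ≤ extensionProduct Q R := monotone_extensionProduct_right _
        (extensionProduct_le_of_isTriangulatedClosed₂ le_rfl le_rfl)

variable [HasCoproducts.{v} C]

lemma extCoprodClosure_sup_le [IsTriangulated C]
    (h : extCoprodClosure R ≤ (extCoprodClosure Q).rightOrthogonal.shift (1 : ℤ)) :
    extCoprodClosure (Q ⊔ R) ≤ extensionProduct (extCoprodClosure Q) (extCoprodClosure R) := by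
  have := isTriangulatedClosed₂_extensionProduct h
  refine extCoprodClosure_le (fun I N c hc hN => ?_) (sup_le ?_ ?_)
  · choose Y Z f g k hT hY hZ using hN
    obtain ⟨f', g', k', hT'⟩ := exists_distTriang_sigma hT
    exact ObjectProperty.prop_of_iso _ ((coproductIsCoproduct N).coconePointUniqueUpToIso hc)
      ⟨_, _, f', g', k', hT', .sigma hY, .sigma hZ⟩
  · exact le_extCoprodClosure.trans (le_extensionProduct_left _)
  · exact le_extCoprodClosure.trans (le_extensionProduct_right _)

end ExtensionProduct

section Weight

variable {C : Type u} [Category.{v} C] [Preadditive C] [HasZeroObject C] [HasShift C ℤ]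
  [∀ n : ℤ, (shiftFunctor C n).Additive] [Pretriangulated C] {Q : ObjectProperty C}

instance isStableUnderShiftBy_one_closure_Ici (n : ℤ) :
    (extCoprodClosure (shifts Q (Set.Ici n))).IsStableUnderShiftBy (1 : ℤ) where
  le_shift := extCoprodClosure_shift (shifts_le_shift (by grind))

instance isStableUnderShiftBy_neg_one_closure_Iic (n : ℤ) :
    (extCoprodClosure (shifts Q (Set.Iic n))).IsStableUnderShiftBy (-1 : ℤ) where
  le_shift := extCoprodClosure_shift (shifts_le_shift (by grind))

lemma IsConnective.closure_shifts_le_rightOrthogonal (hQ : IsConnective Q)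
    (hQc : Q ≤ IsCompactObject) {S S' : Set ℤ} (h : ∀ i ∈ S, ∀ j ∈ S', i < j) :
    extCoprodClosure (shifts Q S') ≤ (extCoprodClosure (shifts Q S)).rightOrthogonal := by
  rw [rightOrthogonal_extCoprodClosure]
  exact extCoprodClosure_le_rightOrthogonal (shifts_le_isCompactObject hQc)
    (hQ.shifts_le_rightOrthogonal h)

variable [HasCoproducts.{v} C] [IsTriangulated C]

lemma localizingClosure_le_extensionProduct (hQ : IsConnective Q) (hQc : Q ≤ IsCompactObject)
    (n : ℤ) : localizingClosure Q ≤ (extCoprodClosure (shifts Q (Set.Iic n))).extensionProduct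
      (extCoprodClosure (shifts Q (Set.Ioi n))) := by
  rw [localizingClosure, ← Set.Iic_union_Ioi (a := n), shifts_union]
  refine extCoprodClosure_sup_le ?_
  calc
    extCoprodClosure (shifts Q (Set.Ioi n))
      ≤ (extCoprodClosure (shifts Q (Set.Ioi n))).shift (1 : ℤ) :=
        extCoprodClosure_shift (shifts_le_shift (by grind))
    _ ≤ _ := fun X hX => hQ.closure_shifts_le_rightOrthogonal hQc (by grind) _ hX

lemma closure_shifts_Ici_eq_rightOrthogonal (hQ : IsConnective Q) (hQc : Q ≤ IsCompactObject)
    (hgen : localizingClosure Q = ⊤) (n : ℤ) :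
    extCoprodClosure (shifts Q (Set.Ici n)) = (shifts Q (Set.Iio n)).rightOrthogonal := by
  rw [← rightOrthogonal_extCoprodClosure]
  refine le_antisymm (hQ.closure_shifts_le_rightOrthogonal hQc (by grind)) fun X hX => ?_
  obtain ⟨L, R, f, g, h, hT, hL, hR⟩ :=
    localizingClosure_le_extensionProduct hQ hQc (n - 1) X (hgen ▸ trivial)
  rw [show Set.Iic (n - 1) = Set.Iio n by grind] at hL
  rw [show Set.Ioi (n - 1) = Set.Ici n by grind] at hR
  have hf : f = 0 := hX f hL
  obtain ⟨r, hr⟩ := Triangle.yoneda_exact₂ _ hT (𝟙 X) (by rw [hf]; exact zero_comp)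
  have := isStableUnderRetracts_of_shift_one (Q := shifts Q (Set.Ici n))
  exact ObjectProperty.prop_of_retract _ ⟨g, r, hr.symm⟩ hR

/-- The weight structure class-generated by a connective class of compact generators. -/
def weightStructure (hQ : IsConnective Q) (hQc : Q ≤ IsCompactObject)
    (hgen : localizingClosure Q = ⊤) : WeightStructure C where
  le := extCoprodClosure (shifts Q (Set.Iic 0))
  ge := extCoprodClosure (shifts Q (Set.Ici 0))
  le_retract := isStableUnderRetracts_of_shift_neg_one
  ge_retract := isStableUnderRetracts_of_shift_one
  le_shift := ObjectProperty.le_shift _ (-1)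
  ge_shift := ObjectProperty.le_shift _ 1
  orthogonal X Y hX hY f := by
    have hY' : extCoprodClosure (shifts Q (Set.Ioi 0)) (Y⟦(1 : ℤ)⟧) :=
      extCoprodClosure_shift (shifts_le_shift (by grind)) Y hY
    exact hQ.closure_shifts_le_rightOrthogonal hQc (by grind) _ hY' f hX
  exists_decomposition M := by
    obtain ⟨L, R, f, g, h, hT, hL, hR⟩ :=
      localizingClosure_le_extensionProduct hQ hQc 0 M (hgen ▸ trivial)
    obtain ⟨f', g', h', hT'⟩ := exists_distTriang_of_iso hT (Iso.refl _) (Iso.refl _)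
      ((shiftEquiv' C (-1 : ℤ) 1 (by simp)).unitIso.app R)
    exact ⟨L, R⟦(-1 : ℤ)⟧, hL, extCoprodClosure_shift (shifts_le_shift (by grind)) R hR,
      f', g', h', hT'⟩

lemma weightStructure_isSmashing (hQ : IsConnective Q) (hQc : Q ≤ IsCompactObject)
    (hgen : localizingClosure Q = ⊤) : (weightStructure hQ hQc hgen).IsSmashing :=
  ⟨inferInstance, fun I => inferInstanceAs
    ((extCoprodClosure (shifts Q (Set.Ici 0))).IsClosedUnderColimitsOfShape (Discrete I))⟩

end Weight

section Truncation

variable {C : Type u} [Category.{v} C] {Q R : ObjectProperty C}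

variable (Q) in
lemma exists_precover [HasCoproducts.{v} C] [ObjectProperty.EssentiallySmall.{v} Q] (X : C) :
    ∃ (I : Type v) (K : I → C) (p : ∐ K ⟶ X), (∀ i, Q (K i)) ∧
      ∀ L, Q L → ∀ x : L ⟶ X, ∃ y, y ≫ p = x := by
  obtain ⟨Q₀, _, hle, hge⟩ := ObjectProperty.EssentiallySmall.exists_small_le.{v} Q
  let e := equivShrink.{v} (Σ K : Subtype Q₀, K.1 ⟶ X)
  refine ⟨_, fun i => (e.symm i).1.1, Sigma.desc fun i => (e.symm i).2,
    fun i => hle _ (e.symm i).1.2, fun L hL x => ?_⟩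
  obtain ⟨K, hK, ⟨f⟩⟩ := hge L hL
  have hlift (j : Σ K : Subtype Q₀, K.1 ⟶ X) :
      ∃ y, y ≫ Sigma.desc (fun i => (e.symm i).2) = j.2 := by
    obtain ⟨i, rfl⟩ := e.symm.surjective j
    exact ⟨Sigma.ι (fun i => (e.symm i).1.1) i, Sigma.ι_desc _ i⟩
  obtain ⟨y, hy⟩ := hlift ⟨⟨K, hK⟩, f.inv ≫ x⟩
  exact ⟨f.hom ≫ y, by simp [hy]⟩

variable [Preadditive C] [HasZeroObject C] [HasShift C ℤ]
  [∀ n : ℤ, (shiftFunctor C n).Additive] [Pretriangulated C]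

instance (S : Set ℤ) [ObjectProperty.EssentiallySmall.{v} Q] :
    ObjectProperty.EssentiallySmall.{v} (shifts Q S) :=
  .of_le (Q := ⨆ i : ℤ, Q.map (shiftFunctor C i)) <| shifts_le_iff.2 fun i _ _ hX =>
    le_iSup (fun i : ℤ => Q.map (shiftFunctor C i)) i _ (Q.prop_map_obj _ hX)

variable [HasCoproducts.{v} C]

lemma exists_kill_kernel [ObjectProperty.EssentiallySmall.{v} Q]
    (hQR : extCoprodClosure Q ≤ (extCoprodClosure R).shift (1 : ℤ)) {A M : C}
    (hA : extCoprodClosure R A) (a : A ⟶ M) :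
    ∃ (A' : C) (a' : A' ⟶ M) (t : A ⟶ A'), extCoprodClosure R A' ∧ t ≫ a' = a ∧
      ∀ K, Q K → ∀ y : K ⟶ A, y ≫ a = 0 → y ≫ t = 0 := by
  obtain ⟨F, f, h, hF⟩ := distinguished_cocone_triangle₁ a
  obtain ⟨I, N, p, hN, hp⟩ := exists_precover Q F
  obtain ⟨A', t, h', hT⟩ := distinguished_cocone_triangle (p ≫ f)
  have hfa : f ≫ a = 0 := comp_distTriang_mor_zero₁₂ _ hF
  have hft : (p ≫ f) ≫ t = 0 := comp_distTriang_mor_zero₁₂ _ hT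
  obtain ⟨a', ha'⟩ : ∃ a', a = t ≫ a' := Triangle.yoneda_exact₂ _ hT a (by
    change (p ≫ f) ≫ a = 0
    rw [Category.assoc, hfa, comp_zero])
  refine ⟨A', a', t, .extension _ (rot_of_distTriang _ hT) hA
    (hQR _ (.sigma fun i => .of _ (hN i))), ha'.symm, fun K hK y hy => ?_⟩
  obtain ⟨w, rfl⟩ : ∃ w, y = w ≫ f := Triangle.coyoneda_exact₂ _ hF y hy
  obtain ⟨z, rfl⟩ := hp K hK w
  rw [Category.assoc, Category.assoc, ← Category.assoc p, hft, comp_zero]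

variable (R) in
lemma exists_approximations [ObjectProperty.EssentiallySmall.{v} R] [R.IsClosedUnderIsomorphisms]
    (M : C) :
    ∃ (A : ℕ → C) (t : ∀ n, A n ⟶ A (n + 1)) (a : ∀ n, A n ⟶ M),
      (∀ n, extCoprodClosure R (A n)) ∧ (∀ n, t n ≫ a (n + 1) = a n) ∧
      (∀ K, R K → ∀ x : K ⟶ M, ∃ y, y ≫ a 0 = x) ∧
      ∀ n K, R K → ∀ y : K⟦(-1 : ℤ)⟧ ⟶ A n, y ≫ a n = 0 → y ≫ t n = 0 := by
  have hR : shifts R {-1} ≤ R.shift (1 : ℤ) := shifts_le_iff.2 fun i hi => by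
    rw [ObjectProperty.shift_shift _ i 1 0 (by grind), ObjectProperty.shift_zero]
  choose! next nextMap t hnext hcomp hkill using fun (A : C) (a : A ⟶ M)
    (hA : extCoprodClosure R A) => exists_kill_kernel (extCoprodClosure_shift hR) hA a
  obtain ⟨I, A₀, a₀, hA₀, hlift⟩ := exists_precover R M
  let s : ℕ → Σ A : C, A ⟶ M :=
    fun n => Nat.rec ⟨∐ A₀, a₀⟩ (fun _ p => ⟨next p.1 p.2, nextMap p.1 p.2⟩) n
  have hs (n) : extCoprodClosure R (s n).1 := by
    induction n with
    | zero => exact .sigma fun i => .of _ (hA₀ i)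
    | succ n ih => exact hnext _ (s n).2 ih
  exact ⟨fun n => (s n).1, fun n => t _ (s n).2, fun n => (s n).2, hs,
    fun n => hcomp _ _ (hs n), hlift,
    fun n K hK => hkill _ _ (hs n) _ (le_shift_shifts (S := {-1}) rfl K hK)⟩

lemma exists_truncation_triangle [ObjectProperty.EssentiallySmall.{v} R]
    [R.IsClosedUnderIsomorphisms] [(extCoprodClosure R).IsStableUnderShiftBy (1 : ℤ)]
    (hR : R ≤ IsCompactObject) (M : C) :
    (extCoprodClosure R).extensionProduct R.rightOrthogonal M := by
  obtain ⟨A, t, a, hA, ha, hlift, hkill⟩ := exists_approximations R M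
  obtain ⟨H, g, h, hT⟩ := distinguished_cocone_triangle (telescope t)
  obtain ⟨k, hk⟩ := exists_telescopeCone_desc hT ha
  have hH : extCoprodClosure R H := .extension _ (rot_of_distTriang _ hT) (.sigma hA)
    (ObjectProperty.le_shift _ 1 _ (.sigma hA))
  obtain ⟨B, p, q, hB⟩ := distinguished_cocone_triangle k
  refine ⟨H, B, k, p, q, hB, hH, fun K x hK => ?_⟩
  have hkp : k ≫ p = 0 := comp_distTriang_mor_zero₁₂ _ hB
  have hqk : q ≫ k⟦(1 : ℤ)⟧' = 0 := comp_distTriang_mor_zero₃₁ _ hB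
  have hxq : x ≫ q = 0 := by
    let e := shiftNegShift K (1 : ℤ)
    obtain ⟨z, hz⟩ := (shiftFunctor C (1 : ℤ)).map_surjective (e.hom ≫ x ≫ q)
    have hzk : z ≫ k = 0 := (shiftFunctor C (1 : ℤ)).map_injective (by simp [hz, hqk])
    obtain ⟨n, y, rfl⟩ := ((hR K hK).shift (-1)).exists_eq_comp_of_telescopeCone hT z
    have hy : y ≫ t n = 0 := hkill n K hK y (by simpa [hk] using hzk)
    rw [← cancel_epi e.hom, ← hz, ← comp_ι_comp_telescopeCone hT, reassoc_of% hy]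
    simp
  obtain ⟨y, rfl⟩ : ∃ y, x = y ≫ p := Triangle.coyoneda_exact₃ _ hB x hxq
  obtain ⟨z, rfl⟩ := hlift K hK y
  rw [← hk 0]
  simp [hkp]

end Truncation

section TStructure

variable {C : Type u} [Category.{v} C] [Preadditive C] [HasShift C ℤ] {Q : ObjectProperty C}

lemma rightOrthogonal_shifts_antitone {S S' : Set ℤ} (h : S ⊆ S') :
    (shifts Q S').rightOrthogonal ≤ (shifts Q S).rightOrthogonal :=
  fun _ hX _ f hY => hX f (shifts_mono h _ hY)

variable [∀ n : ℤ, (shiftFunctor C n).Additive]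

lemma rightOrthogonal_shifts_le_shift {S S' : Set ℤ} {n : ℤ} (h : ∀ i ∈ S', i - n ∈ S) :
    (shifts Q S).rightOrthogonal ≤ (shifts Q S').rightOrthogonal.shift n := by
  rintro X hX Y f hY
  obtain ⟨g, hg⟩ := (shiftFunctor C n).map_surjective ((shiftNegShift Y n).hom ≫ f)
  have hg₀ : g = 0 := hX g (shifts_le_shift (by grind) Y hY)
  rw [← cancel_epi (shiftNegShift Y n).hom, ← hg, hg₀, Functor.map_zero, comp_zero]

variable [HasZeroObject C] [Pretriangulated C] [HasCoproducts.{v} C] [IsTriangulated C]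
  [ObjectProperty.EssentiallySmall.{v} Q]

/-- The t-structure adjacent to `weightStructure`. The class `le n` of the cohomological convention
is the homological `C_{t ≥ -n}`, and `ge n` is `C_{t ≤ -n}`. -/
def tStructure (hQ : IsConnective Q) (hQc : Q ≤ IsCompactObject)
    (hgen : localizingClosure Q = ⊤) : TStructure C where
  le n := (shifts Q (Set.Iio (-n))).rightOrthogonal
  ge n := (shifts Q (Set.Ioi (-n))).rightOrthogonal
  le_shift n a n' h := rightOrthogonal_shifts_le_shift (by grind)
  ge_shift n a n' h := rightOrthogonal_shifts_le_shift (by grind)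
  zero' X Y f hX hY := by
    rw [neg_zero, ← closure_shifts_Ici_eq_rightOrthogonal hQ hQc hgen] at hX
    rw [← rightOrthogonal_extCoprodClosure, show Set.Ioi (-1 : ℤ) = Set.Ici 0 by grind] at hY
    exact hY f hX
  le_zero_le := rightOrthogonal_shifts_antitone (by grind)
  ge_one_le := rightOrthogonal_shifts_antitone (by grind)
  exists_triangle_zero_one M := by
    obtain ⟨A, B, f, g, h, hT, hA, hB⟩ := exists_truncation_triangle
      (shifts_le_isCompactObject (S := Set.Ici 0) hQc) M
    rw [closure_shifts_Ici_eq_rightOrthogonal hQ hQc hgen] at hA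
    exact ⟨A, B, by simpa using hA, rightOrthogonal_shifts_antitone (by grind) _ hB, f, g, h, hT⟩

lemma tStructure_le_zero (hQ : IsConnective Q) (hQc : Q ≤ IsCompactObject)
    (hgen : localizingClosure Q = ⊤) :
    (tStructure hQ hQc hgen).le 0 = (shifts Q (Set.Iio 0)).rightOrthogonal := by
  simp [tStructure]

lemma tStructure_ge_zero (hQ : IsConnective Q) (hQc : Q ≤ IsCompactObject)
    (hgen : localizingClosure Q = ⊤) :
    (tStructure hQ hQc hgen).ge 0 = (shifts Q (Set.Ioi 0)).rightOrthogonal := by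
  simp [tStructure]

lemma weightStructure_isAdjacent (hQ : IsConnective Q) (hQc : Q ≤ IsCompactObject)
    (hgen : localizingClosure Q = ⊤) :
    (weightStructure hQ hQc hgen).IsAdjacent (tStructure hQ hQc hgen) :=
  (closure_shifts_Ici_eq_rightOrthogonal hQ hQc hgen 0).trans (tStructure_le_zero hQ hQc hgen).symm

end TStructure

section FullSubcategories

variable {C D : Type*} [Category* C] [Category* D] {F : C ⥤ D}

lemma nonempty_equivalence_of_map_bijective {H : ObjectProperty C} {K : ObjectProperty D}
    (hF : ∀ X, H X → K (F.obj X))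
    (hmap : ∀ X Y, H X → H Y → Function.Bijective (F.map : (X ⟶ Y) → (F.obj X ⟶ F.obj Y)))
    (hsurj : ∀ M, K M → ∃ X, H X ∧ Nonempty (F.obj X ≅ M)) :
    Nonempty (H.FullSubcategory ≌ K.FullSubcategory) := by
  obtain ⟨h⟩ : Nonempty (H.ι ⋙ F).FullyFaithful :=
    (Functor.FullyFaithful.nonempty_iff_map_bijective _).2 fun X Y =>
      (hmap _ _ X.property Y.property).comp (H.fullyFaithfulι.map_bijective X Y)
  have := h.full
  have := h.faithful
  let G : H.FullSubcategory ⥤ K.FullSubcategory := K.lift (H.ι ⋙ F) fun X => hF _ X.property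
  have : G.EssSurj := ⟨fun M => by
    obtain ⟨X, hX, ⟨e⟩⟩ := hsurj M.obj M.property
    exact ⟨⟨X, hX⟩, ⟨K.isoMk e⟩⟩⟩
  have : G.IsEquivalence := {}
  exact ⟨G.asEquivalence⟩

lemma exists_retract_obj_iso [IsIdempotentComplete C] {X : C}
    (hF : Function.Bijective (F.map : (X ⟶ X) → (F.obj X ⟶ F.obj X))) {M : D}
    (r : Retract M (F.obj X)) :
    ∃ Y : C, Nonempty (Retract Y X) ∧ Nonempty (F.obj Y ≅ M) := by
  obtain ⟨e, he⟩ := hF.2 (r.r ≫ r.i)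
  have hee : e ≫ e = e := hF.1 (by simp [he])
  obtain ⟨Y, i, p, hip, hpi⟩ := IsIdempotentComplete.idempotents_split X e hee
  refine ⟨Y, ⟨⟨i, p, hip⟩⟩, ⟨⟨F.map i ≫ r.r, r.i ≫ F.map p, ?_, ?_⟩⟩⟩
  · calc (F.map i ≫ r.r) ≫ r.i ≫ F.map p = F.map i ≫ (r.r ≫ r.i) ≫ F.map p := by
          simp only [Category.assoc]
      _ = F.map ((i ≫ p) ≫ i ≫ p) := by rw [← he, ← hpi]; simp only [F.map_comp, Category.assoc]
      _ = 𝟙 _ := by rw [hip, Category.id_comp, F.map_id]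
  · calc (r.i ≫ F.map p) ≫ F.map i ≫ r.r = r.i ≫ F.map (p ≫ i) ≫ r.r := by
          simp only [F.map_comp, Category.assoc]
      _ = 𝟙 M := by rw [hpi, he]; simp

end FullSubcategories

section Corepresentation

variable {C : Type u} [Category.{v} C] [Preadditive C] {P : C}

variable (P) in
/-- Composition with `f : X ⟶ Y` as a map `Hom(P, X) → Hom(P, Y)` of left modules over
`(End P)ᵐᵒᵖ`. -/
def postcompLinear {X Y : C} (f : X ⟶ Y) : (P ⟶ X) →ₗ[(End P)ᵐᵒᵖ] (P ⟶ Y) :=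
  ((preadditiveCoyonedaObj P).map f).hom

@[simp]
lemma postcompLinear_apply {X Y : C} (f : X ⟶ Y) (x : P ⟶ X) :
    postcompLinear P f x = x ≫ f := rfl

lemma bijective_preadditiveCoyonedaObj_map {X Y : C}
    (hinj : ∀ f : X ⟶ Y, (∀ x : P ⟶ X, x ≫ f = 0) → f = 0)
    (hsurj : ∀ φ : (P ⟶ X) →ₗ[(End P)ᵐᵒᵖ] (P ⟶ Y), ∃ f : X ⟶ Y, ∀ x, x ≫ f = φ x) :
    Function.Bijective ((preadditiveCoyonedaObj P).map : (X ⟶ Y) → _) := by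
  refine ⟨fun f g hfg => ?_, fun φ => ?_⟩
  · rw [← sub_eq_zero]
    refine hinj _ fun x => ?_
    rw [Preadditive.comp_sub, sub_eq_zero]
    exact LinearMap.congr_fun (congrArg (fun ψ => ψ.hom) hfg) x
  · obtain ⟨f, hf⟩ := hsurj φ.hom
    exact ⟨f, ModuleCat.hom_ext (LinearMap.ext hf)⟩

variable [HasCoproducts.{v} C]

/-- If `P` is compact, then `Hom(P, ∐_I P)` is free on the inclusions of the summands. -/
def IsCompactObject.sigmaBasis (hP : IsCompactObject P) (I : Type v) :
    Module.Basis I (End P)ᵐᵒᵖ (P ⟶ ∐ fun _ : I => P) := by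
  classical
  refine .mk (v := fun i => Sigma.ι (fun _ : I => P) i) ?_ ?_
  · rw [linearIndependent_iff']
    intro s a ha j hj
    replace ha : ∑ i ∈ s, (a i).unop ≫ Sigma.ι (fun _ : I => P) i = 0 := ha
    have hπ : (∑ i ∈ s, (a i).unop ≫ Sigma.ι (fun _ : I => P) i) ≫ Sigma.π _ j = (a j).unop := by
      rw [Preadditive.sum_comp, Finset.sum_eq_single_of_mem j hj]
      · simp
      · intro i _ hij
        rw [Category.assoc, Sigma.ι_π_of_ne _ hij, comp_zero]
    rw [ha, zero_comp] at hπ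
    exact MulOpposite.unop_injective hπ.symm
  · rintro x -
    obtain ⟨s, y, rfl⟩ := hP.exists_eq_sum x
    exact Submodule.sum_mem _ fun i _ => Submodule.smul_mem _ (MulOpposite.op (α := End P) (y i))
      (Submodule.subset_span ⟨i, rfl⟩)

lemma IsCompactObject.sigmaBasis_apply (hP : IsCompactObject P) {I : Type v} (i : I) :
    hP.sigmaBasis I i = Sigma.ι (fun _ : I => P) i :=
  Module.Basis.mk_apply _ _ i

lemma IsCompactObject.exists_hom_of_linear (hP : IsCompactObject P) {I : Type v} {X Y : C}
    (p : (∐ fun _ : I => P) ⟶ X) (φ : (P ⟶ X) →ₗ[(End P)ᵐᵒᵖ] (P ⟶ Y)) :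
    ∃ a : (∐ fun _ : I => P) ⟶ Y, ∀ x, x ≫ a = φ (x ≫ p) := by
  refine ⟨Sigma.desc fun i => φ (Sigma.ι (fun _ : I => P) i ≫ p), fun x => ?_⟩
  have : postcompLinear P (Sigma.desc fun i => φ (Sigma.ι (fun _ : I => P) i ≫ p)) =
      φ ∘ₗ postcompLinear P p := (hP.sigmaBasis I).ext fun i => by
    simp [hP.sigmaBasis_apply]
  exact LinearMap.congr_fun this x

lemma bijective_preadditiveCoyonedaObj_map_of_retract (hP : IsCompactObject P) {X Y : C}
    {I : Type v} (r : Retract X (∐ fun _ : I => P)) :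
    Function.Bijective ((preadditiveCoyonedaObj P).map : (X ⟶ Y) → _) := by
  refine bijective_preadditiveCoyonedaObj_map (fun f hf => ?_) fun φ => ?_
  · have : r.r ≫ f = 0 := Sigma.hom_ext _ _ fun i => by rw [← Category.assoc, hf, comp_zero]
    rw [← Category.id_comp f, ← r.retract, Category.assoc, this, comp_zero]
  · obtain ⟨a, ha⟩ := hP.exists_hom_of_linear r.r φ
    exact ⟨r.i ≫ a, fun x => by rw [← Category.assoc, ha]; simp⟩

lemma projective_hom_of_retract (hP : IsCompactObject P) {X : C} {I : Type v}
    (r : Retract X (∐ fun _ : I => P)) : Module.Projective (End P)ᵐᵒᵖ (P ⟶ X) :=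
  have : Module.Projective (End P)ᵐᵒᵖ (P ⟶ ∐ fun _ : I => P) := .of_basis (hP.sigmaBasis I)
  .of_split (postcompLinear P r.i) (postcompLinear P r.r) (LinearMap.ext fun x => by simp)

lemma IsCompactObject.exists_linear_surjective (hP : IsCompactObject P) (M : Type v)
    [AddCommGroup M] [Module (End P)ᵐᵒᵖ M] :
    ∃ Φ : (P ⟶ ∐ fun _ : M => P) →ₗ[(End P)ᵐᵒᵖ] M, Function.Surjective Φ :=
  ⟨(hP.sigmaBasis M).constr ℕ id, fun m => ⟨hP.sigmaBasis M m, by simp⟩⟩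

lemma IsCompactObject.exists_presentation (hP : IsCompactObject P) (M : Type v) [AddCommGroup M]
    [Module (End P)ᵐᵒᵖ M] :
    ∃ (I J : Type v) (d : (∐ fun _ : J => P) ⟶ ∐ fun _ : I => P)
      (Φ : (P ⟶ ∐ fun _ : I => P) →ₗ[(End P)ᵐᵒᵖ] M),
      Function.Surjective Φ ∧ Function.Exact (postcompLinear P d) Φ := by
  obtain ⟨Φ, hΦ⟩ := hP.exists_linear_surjective M
  let d : (∐ fun _ : LinearMap.ker Φ => P) ⟶ ∐ fun _ : M => P := Sigma.desc fun j => j.1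
  have hd (j : LinearMap.ker Φ) : Sigma.ι _ j ≫ d = j.1 := Sigma.ι_desc _ _
  have hΦd : Φ ∘ₗ postcompLinear P d = 0 := (hP.sigmaBasis _).ext fun j => by
    simp [hP.sigmaBasis_apply, hd]
  refine ⟨_, _, d, Φ, hΦ, fun x => ⟨fun hx => ⟨_, hd ⟨x, hx⟩⟩, ?_⟩⟩
  rintro ⟨y, rfl⟩
  exact LinearMap.congr_fun hΦd y

lemma exists_retract_of_projective [IsIdempotentComplete C] (hP : IsCompactObject P)
    (M : ModuleCat.{v} (End P)ᵐᵒᵖ) [Module.Projective (End P)ᵐᵒᵖ M] :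
    ∃ X : C, Nonempty (Retract X (∐ fun _ : M => P)) ∧
      Nonempty ((preadditiveCoyonedaObj P).obj X ≅ M) := by
  obtain ⟨Φ, hΦ⟩ := hP.exists_linear_surjective M
  obtain ⟨σ, hσ⟩ := Module.projective_lifting_property Φ LinearMap.id hΦ
  exact exists_retract_obj_iso (bijective_preadditiveCoyonedaObj_map_of_retract hP (.refl _))
    ⟨ModuleCat.ofHom σ, ModuleCat.ofHom Φ, ModuleCat.hom_ext hσ⟩

lemma nonempty_equivalence_projMod [IsIdempotentComplete C] (hP : IsCompactObject P)
    {H : ObjectProperty C}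
    (hH : ∀ X, H X ↔ ∃ I : Type v, Nonempty (Retract X (∐ fun _ : I => P))) :
    Nonempty (H.FullSubcategory ≌ ProjMod (End P)ᵐᵒᵖ) := by
  refine nonempty_equivalence_of_map_bijective (F := preadditiveCoyonedaObj P)
    (fun X hX => ?_) (fun X Y hX _ => ?_) fun M (_ : Module.Projective _ M) => ?_
  · obtain ⟨I, ⟨r⟩⟩ := (hH X).1 hX
    exact projective_hom_of_retract hP r
  · obtain ⟨I, ⟨r⟩⟩ := (hH X).1 hX
    exact bijective_preadditiveCoyonedaObj_map_of_retract hP r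
  · obtain ⟨X, hX, hM⟩ := exists_retract_of_projective hP M
    exact ⟨X, (hH X).2 ⟨M, hX⟩, hM⟩

end Corepresentation

section Hearts

variable {C : Type u} [Category.{v} C] [Preadditive C] [HasZeroObject C] [HasShift C ℤ]
  [∀ n : ℤ, (shiftFunctor C n).Additive] [Pretriangulated C] [HasCoproducts.{v} C]
  [IsTriangulated C] {Q : ObjectProperty C} [ObjectProperty.EssentiallySmall.{v} Q]

lemma exists_precover_triangle (hQ : IsConnective Q) (hQc : Q ≤ IsCompactObject)
    (hgen : localizingClosure Q = ⊤) {X : C} (hX : extCoprodClosure (shifts Q (Set.Ici 0)) X) :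
    ∃ (I : Type v) (K : I → C) (p : ∐ K ⟶ X) (N : C) (g : X ⟶ N) (h : N ⟶ (∐ K)⟦(1 : ℤ)⟧),
      (∀ i, Q (K i)) ∧ Triangle.mk p g h ∈ distTriang C ∧
      extCoprodClosure (shifts Q (Set.Ici 1)) N ∧ ∀ L, Q L → ∀ x : L ⟶ X, ∃ y, y ≫ p = x := by
  obtain ⟨I, K, p, hK, hp⟩ := exists_precover Q X
  obtain ⟨N, g, h, hT⟩ := distinguished_cocone_triangle p
  refine ⟨I, K, p, N, g, h, hK, hT, ?_, hp⟩
  have hK₁ : extCoprodClosure (shifts Q (Set.Ici 1)) ((∐ K)⟦(1 : ℤ)⟧) :=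
    extCoprodClosure_shift (le_shift_shifts Set.self_mem_Ici) _ (.sigma fun i => .of _ (hK i))
  rw [closure_shifts_Ici_eq_rightOrthogonal hQ hQc hgen] at hX hK₁ ⊢
  rintro L x hL
  obtain ⟨y, rfl⟩ : ∃ y, x = y ≫ g := Triangle.coyoneda_exact₃ _ hT x (hK₁ (x ≫ h) hL)
  obtain ⟨i, hi, M, hM, ⟨e⟩⟩ := hL
  obtain hi | rfl : i < 0 ∨ i = 0 := by grind
  · rw [hX y ⟨i, hi, M, hM, ⟨e⟩⟩, zero_comp]
  · let e' : L ≅ M := e ≪≫ (shiftFunctorZero C ℤ).app M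
    obtain ⟨z, hz⟩ := hp M hM (e'.inv ≫ y)
    have hpg : p ≫ g = 0 := comp_distTriang_mor_zero₁₂ _ hT
    rw [← cancel_epi e'.inv, ← Category.assoc, ← hz, Category.assoc, hpg, comp_zero, comp_zero]

lemma weightStructure_heart_iff (hQ : IsConnective Q) (hQc : Q ≤ IsCompactObject)
    (hgen : localizingClosure Q = ⊤) (X : C) :
    (weightStructure hQ hQc hgen).heart X ↔
      ∃ (I : Type v) (K : I → C), (∀ i, Q (K i)) ∧ Nonempty (Retract X (∐ K)) := by
  constructor
  · rintro ⟨hge, hle⟩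
    obtain ⟨I, K, p, N, g, h, hK, hT, hN, -⟩ := exists_precover_triangle hQ hQc hgen hge
    have hg : g = 0 :=
      hQ.closure_shifts_le_rightOrthogonal hQc (S := Set.Iic 0) (by grind) N hN g hle
    obtain ⟨s, hs⟩ : ∃ s, 𝟙 X = s ≫ p := Triangle.coyoneda_exact₂ _ hT (𝟙 X) (by
      change 𝟙 X ≫ g = 0
      rw [hg, comp_zero])
    exact ⟨I, K, hK, ⟨⟨s, p, hs.symm⟩⟩⟩
  · rintro ⟨I, K, hK, ⟨r⟩⟩
    have hmem {S : Set ℤ} (hS : 0 ∈ S) : extCoprodClosure (shifts Q S) (∐ K) :=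
      .sigma fun i => .of _ (le_shifts hS _ (hK i))
    exact ⟨(weightStructure hQ hQc hgen).ge_retract.of_retract r (hmem Set.self_mem_Ici),
      (weightStructure hQ hQc hgen).le_retract.of_retract r (hmem Set.self_mem_Iic)⟩

lemma tStructure_heart_iff (hQ : IsConnective Q) (hQc : Q ≤ IsCompactObject)
    (hgen : localizingClosure Q = ⊤) (X : C) :
    (tStructure hQ hQc hgen).heart X ↔ extCoprodClosure (shifts Q (Set.Ici 0)) X ∧
      (shifts Q (Set.Ioi 0)).rightOrthogonal X := by
  rw [closure_shifts_Ici_eq_rightOrthogonal hQ hQc hgen, ← tStructure_le_zero hQ hQc hgen,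
    ← tStructure_ge_zero hQ hQc hgen]
  rfl

lemma eq_zero_of_forall_comp_eq_zero (hQ : IsConnective Q) (hQc : Q ≤ IsCompactObject)
    (hgen : localizingClosure Q = ⊤) {X Y : C} (hX : extCoprodClosure (shifts Q (Set.Ici 0)) X)
    (hY : (shifts Q (Set.Ioi 0)).rightOrthogonal Y) (f : X ⟶ Y)
    (hf : ∀ K, Q K → ∀ x : K ⟶ X, x ≫ f = 0) : f = 0 := by
  obtain ⟨I, K, p, N, g, h, hK, hT, hN, -⟩ := exists_precover_triangle hQ hQc hgen hX
  have hpf : p ≫ f = 0 := Sigma.hom_ext _ _ fun i => by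
    rw [← Category.assoc, hf _ (hK i), comp_zero]
  obtain ⟨k, rfl⟩ : ∃ k, f = g ≫ k := Triangle.yoneda_exact₂ _ hT f hpf
  rw [← rightOrthogonal_extCoprodClosure, show Set.Ioi (0 : ℤ) = Set.Ici 1 by grind] at hY
  rw [hY k hN, comp_zero]

/-- The morphism `b` is the truncation `K ⟶ H₀ K`. -/
lemma exists_tStructure_heart_hom_bijective (hQ : IsConnective Q) (hQc : Q ≤ IsCompactObject)
    (hgen : localizingClosure Q = ⊤) {K : C} (hK : extCoprodClosure (shifts Q (Set.Ici 0)) K) :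
    ∃ (X : C) (b : K ⟶ X), (tStructure hQ hQc hgen).heart X ∧
      ∀ L, Q L → Function.Bijective (fun x : L ⟶ K => x ≫ b) := by
  obtain ⟨A, X, a, b, c, hT, hA, hX⟩ := exists_truncation_triangle
    (shifts_le_isCompactObject (S := Set.Ici 1) hQc) K
  have hA₁ : extCoprodClosure (shifts Q (Set.Ici 1)) (A⟦(1 : ℤ)⟧) :=
    ObjectProperty.le_shift _ 1 _ hA
  have hpos {L : C} (hL : Q L) {Z : C} (hZ : extCoprodClosure (shifts Q (Set.Ici 1)) Z)
      (x : L ⟶ Z) : x = 0 :=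
    hQ.closure_shifts_le_rightOrthogonal hQc (S := {0}) (by grind) Z hZ x
      (.of _ (le_shifts (Set.mem_singleton _) _ hL))
  refine ⟨X, b, (tStructure_heart_iff hQ hQc hgen X).2 ⟨?_, ?_⟩, fun L hL => ⟨?_, fun x => ?_⟩⟩
  · exact .extension _ (rot_of_distTriang _ hT) hK
      (extCoprodClosure_mono (shifts_mono (by grind)) _ hA₁)
  · exact rightOrthogonal_shifts_antitone (by grind) _ hX
  · intro x y hxy
    obtain ⟨z, hz⟩ : ∃ z, x - y = z ≫ a := Triangle.coyoneda_exact₂ _ hT (x - y) (by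
      change (x - y) ≫ b = 0
      rw [Preadditive.sub_comp, sub_eq_zero]
      exact hxy)
    rwa [hpos hL hA z, zero_comp, sub_eq_zero] at hz
  · obtain ⟨y, hy⟩ : ∃ y, x = y ≫ b := Triangle.coyoneda_exact₃ _ hT x (hpos hL hA₁ _)
    exact ⟨y, hy.symm⟩

end Hearts

section Modules

variable {C : Type u} [Category.{v} C] [Preadditive C] [HasZeroObject C] [HasShift C ℤ]
  [∀ n : ℤ, (shiftFunctor C n).Additive] [Pretriangulated C] [HasCoproducts.{v} C] {P : C}

lemma exists_hom_equiv_of_module (hQ : IsConnective (ObjectProperty.singleton P))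
    (hP : IsCompactObject P) (M : Type v) [AddCommGroup M] [Module (End P)ᵐᵒᵖ M] :
    ∃ K : C, extCoprodClosure (shifts (ObjectProperty.singleton P) (Set.Ici 0)) K ∧
      Nonempty ((P ⟶ K) ≃ₗ[(End P)ᵐᵒᵖ] M) := by
  obtain ⟨I, J, d, Φ, hΦ, hdΦ⟩ := hP.exists_presentation M
  obtain ⟨K, g, h, hT⟩ := distinguished_cocone_triangle d
  have hmem (I : Type v) : extCoprodClosure (shifts (ObjectProperty.singleton P) (Set.Ici 0))
      (∐ fun _ : I => P) := .sigma fun _ => .of _ (le_shifts Set.self_mem_Ici _ (by simp))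
  refine ⟨K, .extension _ (rot_of_distTriang _ hT) (hmem I)
    (ObjectProperty.le_shift _ 1 _ (hmem J)), ?_⟩
  have hdg : Function.Exact (postcompLinear P d) (postcompLinear P g) := fun x => by
    refine ⟨fun hx => ?_, ?_⟩
    · obtain ⟨y, hy⟩ : ∃ y, x = y ≫ d := Triangle.coyoneda_exact₂ _ hT x hx
      exact ⟨y, hy.symm⟩
    · rintro ⟨y, rfl⟩
      have hdg : d ≫ g = 0 := comp_distTriang_mor_zero₁₂ _ hT
      simp [hdg]
  have hg : Function.Surjective (postcompLinear P g) := fun x => by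
    have hxh : x ≫ h = 0 := hQ.closure_shifts_le_rightOrthogonal
      (ObjectProperty.singleton_le_iff.2 hP) (S := {0}) (S' := Set.Ici 1) (by grind) _
      (extCoprodClosure_shift (shifts_le_shift (by grind)) _ (hmem J)) (x ≫ h)
      (.of _ (le_shifts (Set.mem_singleton _) _ (by simp)))
    obtain ⟨y, hy⟩ : ∃ y, x = y ≫ g := Triangle.coyoneda_exact₃ _ hT x hxh
    exact ⟨y, hy.symm⟩
  have hker : LinearMap.ker (postcompLinear P g) = LinearMap.ker Φ := by
    rw [hdg.linearMap_ker_eq, hdΦ.linearMap_ker_eq]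
  exact ⟨((postcompLinear P g).quotKerEquivOfSurjective hg).symm ≪≫ₗ
    Submodule.quotEquivOfEq _ _ hker ≪≫ₗ Φ.quotKerEquivOfSurjective hΦ⟩

instance : ObjectProperty.EssentiallySmall.{v} (ObjectProperty.singleton P) where
  exists_small_le' := ⟨_, inferInstance, ObjectProperty.le_isoClosure _⟩

variable [IsTriangulated C]

lemma exists_hom_of_linear (hconn : IsConnective (ObjectProperty.singleton P))
    (hP : ObjectProperty.singleton P ≤ IsCompactObject)
    (hgen : localizingClosure (ObjectProperty.singleton P) = ⊤) {X Y : C}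
    (hX : extCoprodClosure (shifts (ObjectProperty.singleton P) (Set.Ici 0)) X)
    (hY : (shifts (ObjectProperty.singleton P) (Set.Ioi 0)).rightOrthogonal Y)
    (φ : (P ⟶ X) →ₗ[(End P)ᵐᵒᵖ] (P ⟶ Y)) : ∃ f : X ⟶ Y, ∀ x, x ≫ f = φ x := by
  obtain ⟨I, K, p, N, g, h, hK, hT, hN, hsurj⟩ := exists_precover_triangle hconn hP hgen hX
  obtain rfl : K = fun _ => P := funext fun i => by simpa [eq_comm] using hK i
  obtain ⟨a, ha⟩ := (hP P (by simp)).exists_hom_of_linear p φ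
  obtain ⟨u, w, hT'⟩ : ∃ (u : N⟦(-1 : ℤ)⟧ ⟶ ∐ fun _ : I => P) (w : X ⟶ N⟦(-1 : ℤ)⟧⟦(1 : ℤ)⟧),
    Triangle.mk u p w ∈ distTriang C := ⟨_, _, inv_rot_of_distTriang _ hT⟩
  have hup : u ≫ p = 0 := comp_distTriang_mor_zero₁₂ _ hT'
  have hua : u ≫ a = 0 := eq_zero_of_forall_comp_eq_zero hconn hP hgen
    (extCoprodClosure_shift (shifts_le_shift (by grind)) _ hN) hY _ fun K hK x => by
      obtain rfl : K = P := by simpa [eq_comm] using hK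
      rw [← Category.assoc, ha, Category.assoc, hup, comp_zero, map_zero]
  obtain ⟨f, rfl⟩ : ∃ f, a = p ≫ f := Triangle.yoneda_exact₂ _ hT' a hua
  refine ⟨f, fun x => ?_⟩
  obtain ⟨y, rfl⟩ := hsurj P (by simp) x
  rw [← ha, Category.assoc]

lemma nonempty_equivalence_moduleCat (hQ : IsConnective (ObjectProperty.singleton P))
    (hP : ObjectProperty.singleton P ≤ IsCompactObject)
    (hgen : localizingClosure (ObjectProperty.singleton P) = ⊤) :
    Nonempty ((tStructure hQ hP hgen).heart.FullSubcategory ≌ ModuleCat.{v} (End P)ᵐᵒᵖ) := by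
  have heart := tStructure_heart_iff hQ hP hgen
  obtain ⟨E⟩ := nonempty_equivalence_of_map_bijective (H := (tStructure hQ hP hgen).heart)
    (K := ⊤) (F := preadditiveCoyonedaObj P) (fun _ _ => trivial)
    (fun X Y hX hY => bijective_preadditiveCoyonedaObj_map
      (fun f hf => eq_zero_of_forall_comp_eq_zero hQ hP hgen ((heart X).1 hX).1
        ((heart Y).1 hY).2 f fun K hK => by
          obtain rfl : K = P := by simpa [eq_comm] using hK
          exact hf)
      (exists_hom_of_linear hQ hP hgen ((heart X).1 hX).1 ((heart Y).1 hY).2))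
    fun M _ => by
      obtain ⟨K, hK, ⟨e⟩⟩ := exists_hom_equiv_of_module hQ (hP P (by simp)) M
      obtain ⟨X, b, hX, hb⟩ := exists_tStructure_heart_hom_bijective hQ hP hgen hK
      exact ⟨X, hX, ⟨((LinearEquiv.ofBijective (postcompLinear P b) (hb P (by simp))).symm ≪≫ₗ
        e).toModuleIso⟩⟩
  exact ⟨E.trans (ObjectProperty.topEquivalence _)⟩

lemma weightStructure_heart_iff_retract (hQ : IsConnective (ObjectProperty.singleton P))
    (hP : ObjectProperty.singleton P ≤ IsCompactObject)
    (hgen : localizingClosure (ObjectProperty.singleton P) = ⊤) (X : C) :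
    (weightStructure hQ hP hgen).heart X ↔
      ∃ I : Type v, Nonempty (Retract X (∐ fun _ : I => P)) := by
  rw [weightStructure_heart_iff]
  refine ⟨?_, fun ⟨I, hI⟩ => ⟨I, _, by simp, hI⟩⟩
  rintro ⟨I, K, hK, hr⟩
  obtain rfl : K = fun _ => P := funext fun i => by simpa [eq_comm] using hK i
  exact ⟨I, hr⟩

end Modules

end WeightT

end

theorem proposition4p1p1 {C : Type u} [Category.{v} C] [Preadditive C] [HasZeroObject C]
    [HasShift C ℤ] [∀ n : ℤ, (shiftFunctor C n).Additive] [Pretriangulated C] [IsTriangulated C]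
    [HasCoproducts.{v} C] (P : C)
    (hP : WeightT.IsCompactlyGeneratedBy (fun _ : PUnit.{v + 1} => P))
    (hconn : WeightT.IsConnective (ObjectProperty.singleton P)) :
    WeightT.IsWellGenerated C ∧
    ∃ w : WeightT.WeightStructure C,
      w.IsClassGeneratedBy (ObjectProperty.singleton P) ∧
      w.IsSmashing ∧
      Nonempty (w.heart.FullSubcategory ≌ WeightT.ProjMod (End P)ᵐᵒᵖ) ∧
      (∀ X : C, w.heart X ↔ ∃ I : Type v, Nonempty (Retract X (∐ fun _ : I => P))) ∧
      ∃ t : TStructure C,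
        w.IsAdjacent t ∧
        Nonempty (t.heart.FullSubcategory ≌ ModuleCat.{v} (End P)ᵐᵒᵖ) ∧
        t.le 0 = (WeightT.shifts (ObjectProperty.singleton P) {i | i < 0}).rightOrthogonal ∧
        t.ge 0 = (WeightT.shifts (ObjectProperty.singleton P) {i | 0 < i}).rightOrthogonal := by
  have hPc : ObjectProperty.singleton P ≤ WeightT.IsCompactObject :=
    ObjectProperty.singleton_le_iff.2 (hP.1.isCompactObject PUnit.unit)
  have hgen : WeightT.localizingClosure (ObjectProperty.singleton P) = ⊤ := by
    rw [← hP.2]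
    congr 1
    ext X
    simp [ObjectProperty.ofObj_iff]
  have heart := WeightT.weightStructure_heart_iff_retract hconn hPc hgen
  have := WeightT.isIdempotentComplete_of_hasCountableCoproducts (C := C)
  exact ⟨⟨_, _, _, hP⟩, WeightT.weightStructure hconn hPc hgen, ⟨inferInstance, rfl, rfl⟩,
    WeightT.weightStructure_isSmashing hconn hPc hgen,
    WeightT.nonempty_equivalence_projMod (hPc P (by simp)) heart, heart,
    WeightT.tStructure hconn hPc hgen, WeightT.weightStructure_isAdjacent hconn hPc hgen,
    WeightT.nonempty_equivalence_moduleCat hconn hPc hgen,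
    WeightT.tStructure_le_zero hconn hPc hgen, WeightT.tStructure_ge_zero hconn hPc hgen⟩
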